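/- Let $(\mathcal{C},\mathbb{E},\mathfrak{s})$ be a small extriangulated category (in the sense of Nakaoka–Palu), and let $\{\mathbb{E}^i\}_{i\ge 1}$ be a family of higher $\mathbb{E}$-extension groups of $\mathcal{C}$, that is, additive bifunctors $\mathbb{E}^i:\mathcal{C}^{op}\times\mathcal{C}\to\mathrm{Ab}$ such that: $\mathbb{E}^1=\mathbb{E}$; every $\mathbb{E}$-triangle $A\xrightarrow{x}B\xrightarrow{y}C\overset{\delta}{\dashrightarrow}$ has, for each $i\ge 1$, exact sequences of functors $$\mathbb{E}^i(C,-)\to\mathbb{E}^i(B,-)\to\mathbb{E}^i(A,-)\to\mathbb{E}^{i+1}(C,-),\qquad \mathbb{E}^i(-,A)\to\mathbb{E}^i(-,B)\to\mathbb{E}^i(-,C)\to\mathbb{E}^{i+1}(-,A)$$ whose connecting morphisms are natural with respect to morphisms of $\mathbb{E}$-triangles; and, for all $i\ge 1$, $\mathbb{E}^i(f,-)=0$ whenever $\mathbb{E}(f,-)=0$, and $\mathbb{E}^i(-,g)=0$ whenever $\mathbb{E}(-,g)=0$. Let $n\geq 0$ and let $\mathcal{X}\subseteq\mathcal{C}$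 be an $(n+2)$-rigid full subcategory: $\mathbb{E}^k(\mathcal{X},\mathcal{X})=0$ for $1\le k\le n+1$. For $m\ge 0$ let $\mathcal{X}_m^{\wedge}$ be the full subcategory of the objects of $\mathcal{X}$-resolution dimension at most $m$, i.e. of the objects $M$ for which there are, for some $0\le k\le m$, conflations $Z_{i+1}\to X_i\to Z_i$ with $X_i\in\mathcal{X}$ $(0\le i\le k)$, $Z_0=M$ and $Z_{k+1}=0$. Let $\overline{\mathcal{X}_n^{\wedge}}$ be the costable category, the quotient of $\mathcal{X}_n^{\wedge}$ by the ideal of all morphisms $f$ in $\mathcal{X}_n^{\wedge}$ with $\mathbb{E}(-,f)=0$ on $\mathcal{C}$. Let $\overline{\mathcal{X}_n^{\wedge}}\mathsf{Mod}$ be the category of additive covariant functors $\overline{\mathcal{X}_n^{\wedge}}\to\mathrm{Ab}$, and let $\overline{\mathcal{X}_n^{\wedge}}\mathrm{fp}$ be its full subcategory of finitely presented functors, i.e. of cokernels of morphisms between finite coproducts of representable functors. Let $\mathbb{G}$ be the contravariant additive functor $$\mathbb{G}:\mathcal{X}_{n+1}^{\wedge}\to\overline{\mathcal{X}_n^{\wedge}}\mathsf{Mod},\qquad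 M\mapsto\mathbb{E}(M,-)|_{\mathcal{X}_n^{\wedge}},\quad h\mapsto\mathbb{E}(h,-)|_{\mathcal{X}_n^{\wedge}},$$ (where $\mathbb{E}(M,-)|_{\mathcal{X}_n^{\wedge}}$ is regarded as a functor on $\overline{\mathcal{X}_n^{\wedge}}$), let $\mathcal{N}:=\mathrm{Ker}(\mathbb{G})$ be the ideal of the morphisms $h$ in $\mathcal{X}_{n+1}^{\wedge}$ with $\mathbb{E}(h,-)|_{\mathcal{X}_n^{\wedge}}=0$, and let $\mathbb{K}$ be the functor on $\mathcal{X}_{n+1}^{\wedge}/\mathcal{N}$ induced by $\mathbb{G}$. Then: (a) $\mathbb{K}$ takes its values in finitely presented functors, and the contravariant additive functor $\mathbb{K}:\mathcal{X}_{n+1}^{\wedge}/\mathcal{N}\to\overline{\mathcal{X}_n^{\wedge}}\mathrm{fp}$ is full and faithful. (b) $\mathcal{N}=[\mathcal{X}]$, where $[\mathcal{X}]$ is the class of all morphisms in $\mathcal{X}_{n+1}^{\wedge}$ that factor through an object of $\mathcal{X}$. -/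

import Mathlib

open CategoryTheory CategoryTheory.Limits Opposite

universe u

/-! ## Ideals of preadditive categories and quotients by them -/

/-- A two-sided ideal of a preadditive category: a subgroup of every group of morphisms, stable
under composition with arbitrary morphisms on both sides. -/
structure HomIdeal (A : Type u) [Category.{u} A] [Preadditive A] where
  mem : ∀ X Y : A, AddSubgroup (X ⟶ Y)
  comp_left : ∀ {X Y Z : A} (f : X ⟶ Y) (g : Y ⟶ Z), g ∈ mem Y Z → f ≫ g ∈ mem X Z
  comp_right : ∀ {X Y Z : A} (f : X ⟶ Y) (g : Y ⟶ Z), f ∈ mem X Y → f ≫ g ∈ mem X Z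

namespace HomIdeal

variable {A : Type u} [Category.{u} A] [Preadditive A]

/-- The class of morphisms that belong to an ideal. -/
def morphisms (I : HomIdeal A) : MorphismProperty A := fun X Y f => f ∈ I.mem X Y

/-- Two morphisms are identified modulo `I` when their difference belongs to `I`. -/
def rel (I : HomIdeal A) : HomRel A := fun X Y f g => f - g ∈ I.mem X Y

instance (I : HomIdeal A) : Congruence I.rel where
  equivalence {X Y} :=
    { refl := fun f => by
        change f - f ∈ I.mem X Y
        rw [sub_self]
        exact (I.mem X Y).zero_mem
      symm := fun {f g} h => by
        change g - f ∈ I.mem X Y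
        rw [← neg_sub]
        exact (I.mem X Y).neg_mem h
      trans := fun {f g k} h₁ h₂ => by
        change f - k ∈ I.mem X Y
        rw [← sub_add_sub_cancel f g k]
        exact (I.mem X Y).add_mem h₁ h₂ }
  comp_left {X Y Z} f g g' h := by
    change f ≫ g - f ≫ g' ∈ I.mem X Z
    rw [← Preadditive.comp_sub]
    exact I.comp_left _ _ h
  comp_right {X Y Z} f f' g h := by
    change f ≫ g - f' ≫ g ∈ I.mem X Z
    rw [← Preadditive.sub_comp]
    exact I.comp_right _ _ h

theorem rel_add (I : HomIdeal A) ⦃X Y : A⦄ (f₁ f₂ g₁ g₂ : X ⟶ Y) (hf : I.rel f₁ f₂)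
    (hg : I.rel g₁ g₂) : I.rel (f₁ + g₁) (f₂ + g₂) := by
  change f₁ + g₁ - (f₂ + g₂) ∈ I.mem X Y
  rw [add_sub_add_comm]
  exact (I.mem X Y).add_mem hf hg

/-- The quotient category `A / I`. -/
abbrev Quot (I : HomIdeal A) : Type u := CategoryTheory.Quotient I.rel

instance (I : HomIdeal A) : Preadditive I.Quot :=
  CategoryTheory.Quotient.preadditive I.rel I.rel_add

/-- The projection functor `A ⥤ A / I`. -/
abbrev proj (I : HomIdeal A) : A ⥤ I.Quot := CategoryTheory.Quotient.functor I.rel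

instance (I : HomIdeal A) : I.proj.Additive :=
  CategoryTheory.Quotient.functor_additive I.rel I.rel_add

universe w₁ w₂

variable {B : Type w₁} [Category.{w₂} B] [Preadditive B]

/-- The functor `A / I ⥤ B` induced by an additive functor `A ⥤ B` that kills `I`. -/
def lift (I : HomIdeal A) (F : A ⥤ B) [F.Additive]
    (hF : ∀ (X Y : A) (f : X ⟶ Y), f ∈ I.mem X Y → F.map f = 0) : I.Quot ⥤ B :=
  CategoryTheory.Quotient.lift I.rel F fun X Y f g h => by
    have := hF X Y (f - g) h
    rwa [F.map_sub, sub_eq_zero] at this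

instance (I : HomIdeal A) (F : A ⥤ B) [F.Additive]
    (hF : ∀ (X Y : A) (f : X ⟶ Y), f ∈ I.mem X Y → F.map f = 0) : (I.lift F hF).Additive where
  map_add := by
    rintro X Y ⟨f⟩ ⟨g⟩
    exact F.map_add (f := f) (g := g)

/-- The kernel of an additive functor: the ideal of the morphisms that it sends to zero. -/
def ker (F : A ⥤ B) [F.Additive] : HomIdeal A where
  mem X Y := (F.mapAddHom (X := X) (Y := Y)).ker
  comp_left f g hg := by
    have hg' : F.map g = 0 := hg
    change F.map (f ≫ g) = 0
    rw [F.map_comp, hg', comp_zero]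
  comp_right f g hf := by
    have hf' : F.map f = 0 := hf
    change F.map (f ≫ g) = 0
    rw [F.map_comp, hf', zero_comp]

end HomIdeal

/-! ## Left modules over a small preadditive category -/

section Modules

variable (A : Type u) [Category.{u} A] [Preadditive A]

/-- Left `A`-modules: additive covariant functors from `A` to abelian groups. -/
abbrev LeftMod := A ⥤+ AddCommGrpCat.{u}

/-- A left `A`-module is finitely presented if it is a cokernel of a morphism between finite
coproducts of representable functors `A(Z, -)`. (Coproducts and cokernels of additive functors are
computed pointwise, so they may be formed in the category of all functors.) -/
def IsFinitelyPresentedLeftMod : ObjectProperty (LeftMod A) := fun F =>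
  ∃ (k l : ℕ) (Z : Fin k → A) (W : Fin l → A)
    (f : (∐ fun i => preadditiveCoyoneda.obj (op (Z i))) ⟶
      (∐ fun j => preadditiveCoyoneda.obj (op (W j)))),
    Nonempty (cokernel f ≅ F.obj)

/-- The category of finitely presented left `A`-modules. -/
abbrev LeftFp := (IsFinitelyPresentedLeftMod A).FullSubcategory

end Modules

/-! ## Extriangulated categories -/

/-- A sequence `left --f--> mid --g--> right` with prescribed end terms. -/
structure EndSeq {C : Type u} [Category.{u} C] (left right : C) where
  mid : C
  f : left ⟶ mid
  g : mid ⟶ right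

/-- Two sequences with the same end terms are equivalent if there is an isomorphism between their
middle terms that is compatible with the end terms. -/
instance endSeqSetoid {C : Type u} [Category.{u} C] (left right : C) :
    Setoid (EndSeq left right) where
  r S S' := ∃ b : S.mid ≅ S'.mid, S.f ≫ b.hom = S'.f ∧ b.hom ≫ S'.g = S.g
  iseqv :=
    { refl := fun S => ⟨Iso.refl _, by simp, by simp⟩
      symm := by
        rintro S S' ⟨b, h₁, h₂⟩
        exact ⟨b.symm, by simp [← h₁], by simp [← h₂]⟩
      trans := by
        rintro S S' S'' ⟨b, h₁, h₂⟩ ⟨b', h₁', h₂'⟩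
        exact ⟨b ≪≫ b', by simp [← h₁', ← h₁], by simp [← h₂, ← h₂']⟩ }

/-- Functors `Cᵒᵖ × C → Ab`, in curried form. -/
abbrev AbBifunctor (C : Type u) [Category.{u} C] := Cᵒᵖ ⥤ C ⥤ AddCommGrpCat.{u}

namespace AbBifunctor

variable {C : Type u} [Category.{u} C]

/-- The group `E(Z, A)`. -/
abbrev Elt (E : AbBifunctor C) (Z A : C) : Type u := (E.obj (op Z)).obj A

/-- `a · δ = E(Z, a)(δ)`. -/
def push (E : AbBifunctor C) {Z A A' : C} (a : A ⟶ A') (δ : E.Elt Z A) : E.Elt Z A' :=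
  (E.obj (op Z)).map a δ

/-- `δ · c = E(c, A)(δ)`. -/
def pull (E : AbBifunctor C) {Z Z' A : C} (δ : E.Elt Z A) (c : Z' ⟶ Z) : E.Elt Z' A :=
  (E.map c.op).app A δ

/-- Additivity in each of the two variables. -/
structure IsBiadditive [Preadditive C] (E : AbBifunctor C) : Prop where
  left : E.Additive
  right : ∀ Z, (E.obj Z).Additive

/-- The extension `δ ⊕ δ' ∈ E(Z ⊕ Z', A ⊕ A')`, with components `(δ, 0, 0, δ')`. -/
noncomputable def directSum [Preadditive C] [HasBinaryBiproducts C] (E : AbBifunctor C)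
    {Z A Z' A' : C} (δ : E.Elt Z A) (δ' : E.Elt Z' A') : E.Elt (Z ⊞ Z') (A ⊞ A') :=
  E.push biprod.inl (E.pull δ biprod.fst) + E.push biprod.inr (E.pull δ' biprod.snd)

/-- A rule `𝔰` that attaches to every `δ ∈ E(Z, A)` an equivalence class of sequences
`A ⟶ B ⟶ Z`. -/
abbrev Correspondence (E : AbBifunctor C) :=
  ∀ (Z A : C), E.Elt Z A → _root_.Quotient (endSeqSetoid A Z)

/-- `𝔰(δ) = [A --x--> B --y--> Z]`. -/
def Correspondence.Realizes {E : AbBifunctor C} (s : E.Correspondence) {A B Z : C}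
    (x : A ⟶ B) (y : B ⟶ Z) (δ : E.Elt Z A) : Prop :=
  s Z A δ = Quotient.mk _ ⟨B, x, y⟩

end AbBifunctor

/-- An external triangulation `(𝔼, 𝔰)` of an additive category. A category equipped with an external
triangulation is an extriangulated category. -/
structure ExternalTriangulation (C : Type u) [Category.{u} C] [Preadditive C]
    [HasZeroObject C] [HasBinaryBiproducts C] where
  E : AbBifunctor C
  /-- (ET1) -/
  biadditive : E.IsBiadditive
  s : E.Correspondence
  /-- (ET2): `𝔰` is a realization. -/
  realization : ∀ {A B Z A' B' Z' : C} {x : A ⟶ B} {y : B ⟶ Z} {δ : E.Elt Z A}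
    {x' : A' ⟶ B'} {y' : B' ⟶ Z'} {δ' : E.Elt Z' A'},
    s.Realizes x y δ → s.Realizes x' y' δ' →
    ∀ (a : A ⟶ A') (c : Z ⟶ Z'), E.push a δ = E.pull δ' c →
      ∃ b : B ⟶ B', x ≫ b = a ≫ x' ∧ y ≫ c = b ≫ y'
  /-- (ET2): `𝔰` is additive, zero extensions. -/
  realizes_zero : ∀ A Z : C,
    s.Realizes (biprod.inl : A ⟶ A ⊞ Z) (biprod.snd : A ⊞ Z ⟶ Z) 0
  /-- (ET2): `𝔰` is additive, direct sums. -/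
  realizes_directSum : ∀ {A B Z A' B' Z' : C} {x : A ⟶ B} {y : B ⟶ Z} {δ : E.Elt Z A}
    {x' : A' ⟶ B'} {y' : B' ⟶ Z'} {δ' : E.Elt Z' A'},
    s.Realizes x y δ → s.Realizes x' y' δ' →
      s.Realizes (biprod.map x x') (biprod.map y y') (E.directSum δ δ')
  /-- (ET3) -/
  et3 : ∀ {A B Z A' B' Z' : C} {x : A ⟶ B} {y : B ⟶ Z} {δ : E.Elt Z A}
    {x' : A' ⟶ B'} {y' : B' ⟶ Z'} {δ' : E.Elt Z' A'},
    s.Realizes x y δ → s.Realizes x' y' δ' →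
    ∀ (a : A ⟶ A') (b : B ⟶ B'), x ≫ b = a ≫ x' →
      ∃ c : Z ⟶ Z', y ≫ c = b ≫ y' ∧ E.push a δ = E.pull δ' c
  /-- (ET3)ᵒᵖ -/
  et3_op : ∀ {A B Z A' B' Z' : C} {x : A ⟶ B} {y : B ⟶ Z} {δ : E.Elt Z A}
    {x' : A' ⟶ B'} {y' : B' ⟶ Z'} {δ' : E.Elt Z' A'},
    s.Realizes x y δ → s.Realizes x' y' δ' →
    ∀ (b : B ⟶ B') (c : Z ⟶ Z'), y ≫ c = b ≫ y' →
      ∃ a : A ⟶ A', x ≫ b = a ≫ x' ∧ E.push a δ = E.pull δ' c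
  /-- (ET4) -/
  et4 : ∀ {A B D K F : C} {f : A ⟶ B} {f' : B ⟶ D} {δ : E.Elt D A}
    {g : B ⟶ K} {g' : K ⟶ F} {δ' : E.Elt F B},
    s.Realizes f f' δ → s.Realizes g g' δ' →
    ∃ (L : C) (h : A ⟶ K) (h' : K ⟶ L) (d : D ⟶ L) (e : L ⟶ F) (δ'' : E.Elt L A),
      h = f ≫ g ∧ f' ≫ d = g ≫ h' ∧ h' ≫ e = g' ∧
      s.Realizes h h' δ'' ∧ s.Realizes d e (E.push f' δ') ∧
      E.pull δ'' d = δ ∧ E.push f δ'' = E.pull δ' e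
  /-- (ET4)ᵒᵖ -/
  et4_op : ∀ {D A B F K : C} {f' : D ⟶ A} {f : A ⟶ B} {δ : E.Elt B D}
    {g' : F ⟶ B} {g : B ⟶ K} {δ' : E.Elt K F},
    s.Realizes f' f δ → s.Realizes g' g δ' →
    ∃ (L : C) (d : D ⟶ L) (e : L ⟶ F) (h' : L ⟶ A) (h : A ⟶ K) (δ'' : E.Elt K L),
      d ≫ h' = f' ∧ e ≫ g' = h' ≫ f ∧ h = f ≫ g ∧
      s.Realizes h' h δ'' ∧ s.Realizes d e (E.pull δ g') ∧
      δ' = E.push e δ'' ∧ E.push d δ = E.pull δ'' g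

namespace ExternalTriangulation

variable {C : Type u} [Category.{u} C] [Preadditive C] [HasZeroObject C] [HasBinaryBiproducts C]

/-- A conflation is a sequence that realizes some extension. -/
def IsConflation (T : ExternalTriangulation C) {A B Z : C} (x : A ⟶ B) (y : B ⟶ Z) : Prop :=
  ∃ δ : T.E.Elt Z A, T.s.Realizes x y δ

/-! ### Resolutions -/

/-- `T.HasResolution 𝒳 n M`: the object `M` admits a finite `𝒳`-resolution
`0 ⟶ Xₙ ⟶ ⋯ ⟶ X₁ ⟶ X₀ ⟶ M ⟶ 0` of length `n`, that is, there are conflations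
`Zᵢ₊₁ ⟶ Xᵢ ⟶ Zᵢ` with `Xᵢ` in `𝒳` for `0 ≤ i ≤ n`, where `Z₀ = M` and `Zₙ₊₁` is a zero object. -/
inductive HasResolution (T : ExternalTriangulation C) (𝒳 : ObjectProperty C) : ℕ → C → Prop
  | zero {Z X M : C} (x : Z ⟶ X) (y : X ⟶ M) (hZ : IsZero Z) (hX : 𝒳 X)
      (h : T.IsConflation x y) : HasResolution T 𝒳 0 M
  | succ {n : ℕ} {Z X M : C} (x : Z ⟶ X) (y : X ⟶ M) (hZ : HasResolution T 𝒳 n Z) (hX : 𝒳 X)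
      (h : T.IsConflation x y) : HasResolution T 𝒳 (n + 1) M

/-- The `𝒳`-resolution dimension: the least length of a finite `𝒳`-resolution, and `⊤` if there is
no such resolution. -/
noncomputable def resdim (T : ExternalTriangulation C) (𝒳 : ObjectProperty C) (M : C) : ℕ∞ :=
  ⨅ (n : ℕ) (_ : T.HasResolution 𝒳 n M), (n : ℕ∞)

/-- The class `𝒳ₙ^∧` of the objects of `𝒳`-resolution dimension at most `n`. -/
def resdimLE (T : ExternalTriangulation C) (𝒳 : ObjectProperty C) (n : ℕ) : ObjectProperty C :=
  fun M => T.resdim 𝒳 M ≤ n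

/-! ### Higher extension groups and rigid subcategories -/

/-- A family `(𝔼ⁱ)_{i ≥ 1}` of higher `𝔼`-extension groups. The value `ext 0` plays no role. -/
structure HigherExtensions (T : ExternalTriangulation C) where
  ext : ℕ → AbBifunctor C
  biadditive : ∀ i, 1 ≤ i → (ext i).IsBiadditive
  ext_one : ext 1 = T.E
  /-- The natural transformation `𝔼ⁱ(A, -) ⟶ 𝔼ⁱ⁺¹(Z, -)` of an extension `δ ∈ 𝔼(Z, A)`. -/
  conn : ∀ i, 1 ≤ i → ∀ {Z A : C}, T.E.Elt Z A → ((ext i).obj (op A) ⟶ (ext (i + 1)).obj (op Z))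
  /-- The natural transformation `𝔼ⁱ(-, Z) ⟶ 𝔼ⁱ⁺¹(-, A)` of an extension `δ ∈ 𝔼(Z, A)`. -/
  conn' : ∀ i, 1 ≤ i → ∀ {Z A : C}, T.E.Elt Z A → ((ext i).flip.obj Z ⟶ (ext (i + 1)).flip.obj A)
  exact_mid : ∀ i, 1 ≤ i → ∀ {A B Z : C} {x : A ⟶ B} {y : B ⟶ Z} {δ : T.E.Elt Z A},
    T.s.Realizes x y δ → ∀ Y : C,
      Function.Exact (((ext i).map y.op).app Y) (((ext i).map x.op).app Y)
  exact_conn : ∀ i (hi : 1 ≤ i) {A B Z : C} {x : A ⟶ B} {y : B ⟶ Z} {δ : T.E.Elt Z A},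
    T.s.Realizes x y δ → ∀ Y : C,
      Function.Exact (((ext i).map x.op).app Y) ((conn i hi δ).app Y)
  exact_mid' : ∀ i, 1 ≤ i → ∀ {A B Z : C} {x : A ⟶ B} {y : B ⟶ Z} {δ : T.E.Elt Z A},
    T.s.Realizes x y δ → ∀ Y : C,
      Function.Exact (((ext i).obj (op Y)).map x) (((ext i).obj (op Y)).map y)
  exact_conn' : ∀ i (hi : 1 ≤ i) {A B Z : C} {x : A ⟶ B} {y : B ⟶ Z} {δ : T.E.Elt Z A},
    T.s.Realizes x y δ → ∀ Y : C,
      Function.Exact (((ext i).obj (op Y)).map y) ((conn' i hi δ).app (op Y))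
  /-- Naturality of `conn` for morphisms of extensions; these are the morphisms of
  `𝔼`-triangles, since the middle component always exists and does not intervene. -/
  conn_naturality : ∀ i (hi : 1 ≤ i) {Z A Z' A' : C} (δ : T.E.Elt Z A) (δ' : T.E.Elt Z' A')
    (a : A ⟶ A') (c : Z ⟶ Z'), T.E.push a δ = T.E.pull δ' c →
      (ext i).map a.op ≫ conn i hi δ = conn i hi δ' ≫ (ext (i + 1)).map c.op
  conn'_naturality : ∀ i (hi : 1 ≤ i) {Z A Z' A' : C} (δ : T.E.Elt Z A) (δ' : T.E.Elt Z' A')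
    (a : A ⟶ A') (c : Z ⟶ Z'), T.E.push a δ = T.E.pull δ' c →
      conn' i hi δ ≫ (ext (i + 1)).flip.map a = (ext i).flip.map c ≫ conn' i hi δ'
  /-- `𝔼ⁱ(f, -) = 0` for every `𝔼`-projective morphism `f`. -/
  map_projective : ∀ i, 1 ≤ i → ∀ {X Y : C} (f : X ⟶ Y),
    T.E.map f.op = 0 → (ext i).map f.op = 0
  /-- `𝔼ⁱ(-, g) = 0` for every `𝔼`-injective morphism `g`. -/
  map_injective : ∀ i, 1 ≤ i → ∀ {X Y : C} (g : X ⟶ Y),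
    T.E.flip.map g = 0 → (ext i).flip.map g = 0

/-- `𝒳` is `m`-rigid if `𝔼ᵏ(𝒳, 𝒳) = 0` for all `1 ≤ k ≤ m - 1`. -/
def HigherExtensions.IsRigid {T : ExternalTriangulation C} (H : T.HigherExtensions) (m : ℕ)
    (𝒳 : ObjectProperty C) : Prop :=
  ∀ k : ℕ, 1 ≤ k → k + 1 ≤ m → ∀ X Y : C, 𝒳 X → 𝒳 Y → ∀ e : (H.ext k).Elt X Y, e = 0

/-! ### Costable categories and the functors `𝔾` and `𝕂` -/

section Functors

variable (T : ExternalTriangulation C)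

instance : T.E.Additive := T.biadditive.left

instance (Z : Cᵒᵖ) : (T.E.obj Z).Additive := T.biadditive.right Z

instance : T.E.flip.Additive where
  map_add {X Y f g} := by
    ext Z : 2
    exact (T.E.obj Z).map_add

/-- For a class `𝒴` of objects, the ideal of the full subcategory `𝒴` formed by the morphisms `f`
in `𝒴` with `𝔼(-, f) = 0`, where `𝔼(-, f)` is taken on the whole category. -/
def injectiveIdeal (𝒴 : ObjectProperty C) : HomIdeal 𝒴.FullSubcategory :=
  HomIdeal.ker (𝒴.ι ⋙ T.E.flip)

/-- The costable category of a class of objects. -/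
abbrev Costable (𝒴 : ObjectProperty C) : Type u := (T.injectiveIdeal 𝒴).Quot

/-- The left module over the costable category of `𝒴` induced by the restriction of `𝔼(M, -)`
to `𝒴`. -/
def costableModule (𝒴 : ObjectProperty C) (M : Cᵒᵖ) : LeftMod (T.Costable 𝒴) :=
  AdditiveFunctor.of ((T.injectiveIdeal 𝒴).lift (𝒴.ι ⋙ T.E.obj M) fun _ _ _ hf =>
    NatTrans.congr_app (show T.E.flip.map _ = 0 from hf) M)

/-- `M ↦ 𝔼(M, -)|_𝒴`, with `h ↦ 𝔼(h, -)|_𝒴`. -/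
def costableFunctor (𝒴 : ObjectProperty C) : Cᵒᵖ ⥤ LeftMod (T.Costable 𝒴) where
  obj M := T.costableModule 𝒴 M
  map h := ObjectProperty.homMk
    (CategoryTheory.Quotient.natTransLift _ (Functor.whiskerLeft 𝒴.ι (T.E.map h)))
  map_id M := by
    ext ⟨Y⟩ : 3
    exact NatTrans.congr_app (T.E.map_id M) Y.obj
  map_comp h k := by
    ext ⟨Y⟩ : 3
    exact NatTrans.congr_app (T.E.map_comp h k) Y.obj

instance (𝒴 : ObjectProperty C) : (T.costableFunctor 𝒴).Additive where
  map_add {M N h k} := by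
    ext ⟨Y⟩ : 3
    exact NatTrans.congr_app (T.E.map_add (f := h) (g := k)) Y.obj

/-- The contravariant functor `𝔾` from `𝒳ₙ₊₁^∧` to the left modules over the costable category of
`𝒳ₙ^∧`, `M ↦ 𝔼(M, -)|_{𝒳ₙ^∧}`. -/
def functorG (𝒳 : ObjectProperty C) (n : ℕ) :
    (T.resdimLE 𝒳 (n + 1)).FullSubcategoryᵒᵖ ⥤ LeftMod (T.Costable (T.resdimLE 𝒳 n)) :=
  (T.resdimLE 𝒳 (n + 1)).ι.op ⋙ T.costableFunctor (T.resdimLE 𝒳 n)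

instance (𝒳 : ObjectProperty C) (n : ℕ) : (T.functorG 𝒳 n).Additive :=
  inferInstanceAs ((T.resdimLE 𝒳 (n + 1)).ι.op ⋙ T.costableFunctor _).Additive

instance (𝒳 : ObjectProperty C) (n : ℕ) : (T.functorG 𝒳 n).rightOp.Additive where
  map_add {_ _ f g} := congrArg Quiver.Hom.op ((T.functorG 𝒳 n).map_add (f := f.op) (g := g.op))

/-- The ideal `𝒩 = Ker 𝔾` of `𝒳ₙ₊₁^∧`. -/
def idealN (𝒳 : ObjectProperty C) (n : ℕ) :
    HomIdeal (T.resdimLE 𝒳 (n + 1)).FullSubcategory :=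
  HomIdeal.ker (T.functorG 𝒳 n).rightOp

/-- The contravariant functor `𝕂` from `𝒳ₙ₊₁^∧ / 𝒩` to the left modules over the costable category
of `𝒳ₙ^∧` that is induced by `𝔾`. -/
def functorK (𝒳 : ObjectProperty C) (n : ℕ) :
    (T.idealN 𝒳 n).Quotᵒᵖ ⥤ LeftMod (T.Costable (T.resdimLE 𝒳 n)) :=
  ((T.idealN 𝒳 n).lift (T.functorG 𝒳 n).rightOp fun _ _ _ hf => hf).leftOp

end Functors

end ExternalTriangulation

/-- For full subcategories given by classes of objects `𝒳` and `𝒴`, the class `[𝒳]` of the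
morphisms between objects of `𝒴` that factor through an object of `𝒳`. -/
def factorsThroughClass {C : Type u} [Category.{u} C] (𝒳 𝒴 : ObjectProperty C) :
    MorphismProperty 𝒴.FullSubcategory :=
  fun M N h => ∃ (X : C) (_ : 𝒳 X) (f : M.obj ⟶ X) (g : X ⟶ N.obj), h.hom = f ≫ g

/-!
Let `M` be an object of `𝒳ₙ₊₁^∧`. The first step of a resolution of `M` is a conflation
`Z ⟶ X ⟶ M` with `X` in `𝒳` and `Z` in `𝒳ₙ^∧`, and it realizes some `δ ∈ 𝔼(M, Z)`. Rigidity and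
dimension shifting give `𝔼(X, Y) = 0` for all `Y` in `𝒳ₙ^∧`
(`HigherExtensions.IsRigid.elt_eq_zero`). The exact sequence
`C(X, Y) ⟶ C(Z, Y) ⟶ 𝔼(M, Y) ⟶ 𝔼(X, Y) = 0` therefore says that `δ` generates the module
`𝔼(M, -)` on `𝒳ₙ^∧`, and that its relations are the morphisms that factor through `Z ⟶ X`. This is a
presentation over the costable category, since `X` itself lies in `𝒳ₙ^∧`
(`costableModule_isFinitelyPresented`).

Morphisms into `M` are recovered from the other exact sequence
`C(L, X) ⟶ C(L, M) ⟶ 𝔼(L, Z) ⟶ 𝔼(L, X)`.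
A natural transformation `φ : 𝔼(M, -) ⟶ 𝔼(L, -)` is determined by `φ(δ)`, which dies in `𝔼(L, X)`
because `δ` dies in `𝔼(M, X)`; hence `φ(δ) = δ · f` for some `f : L ⟶ M`, and `φ` is induced by `f`
(`costableFunctor_full`). Exactness at `C(L, M)` shows that `f` induces the zero map only if it
factors through `X`, and this identifies `𝒩` (`morphisms_idealN`). Faithfulness of `𝕂` holds by
construction, as `𝒩` is the kernel of `𝔾`.

The class `𝒳` is not assumed to contain zero objects, so the objects with a resolution of length `0`
are treated separately: they are retracts of objects of `𝒳`, and `𝔼(M, -)` vanishes on `𝒳ₙ^∧` for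
such `M`.
-/

/-! ### Functoriality of extension groups -/

namespace AbBifunctor

variable {C : Type u} [Category.{u} C] (E : AbBifunctor C)

theorem push_id {Z A : C} (δ : E.Elt Z A) : E.push (𝟙 A) δ = δ := by
  simp [push]

theorem push_zero_left [Preadditive C] (hE : E.IsBiadditive) {Z A A' : C} (δ : E.Elt Z A) :
    E.push (0 : A ⟶ A') δ = 0 := by
  have := hE.right (op Z)
  simp [push]

theorem pull_comp {Z Z' Z'' A : C} (δ : E.Elt Z A) (c : Z' ⟶ Z) (d : Z'' ⟶ Z') :
    E.pull δ (d ≫ c) = E.pull (E.pull δ c) d := by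
  simp [pull]

theorem pull_id {Z A : C} (δ : E.Elt Z A) : E.pull δ (𝟙 Z) = δ := by
  simp [pull]

theorem pull_zero {Z Z' A : C} (c : Z' ⟶ Z) : E.pull (0 : E.Elt Z A) c = 0 :=
  map_zero ((E.map c.op).app A).hom

theorem push_pull {Z Z' A A' : C} (a : A ⟶ A') (δ : E.Elt Z A) (c : Z' ⟶ Z) :
    E.push a (E.pull δ c) = E.pull (E.push a δ) c :=
  (ConcreteCategory.congr_hom ((E.map c.op).naturality a) δ).symm

end AbBifunctor

namespace ExternalTriangulation

variable {C : Type u} [Category.{u} C] [Preadditive C] [HasZeroObject C] [HasBinaryBiproducts C]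
  (T : ExternalTriangulation C)

theorem exists_realizes {Z A : C} (δ : T.E.Elt Z A) :
    ∃ (B : C) (x : A ⟶ B) (y : B ⟶ Z), T.s.Realizes x y δ := by
  obtain ⟨⟨B, x, y⟩, h⟩ := Quotient.exists_rep (T.s Z A δ)
  exact ⟨B, x, y, h.symm⟩

/-! ### Exact sequences of a realized extension -/

variable {T} {A B Z : C} {x : A ⟶ B} {y : B ⟶ Z} {δ : T.E.Elt Z A}

/-- Exactness of `C(B, Y) ⟶ C(A, Y) ⟶ 𝔼(Z, Y)` at the middle term: the extension `f · δ = 0` is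
realized by a split sequence, whose retraction yields the factorization. -/
theorem exists_inflation_comp_eq (h : T.s.Realizes x y δ) {Y : C} (f : A ⟶ Y)
    (hf : T.E.push f δ = 0) : ∃ g : B ⟶ Y, x ≫ g = f := by
  obtain ⟨b, hb, -⟩ := T.realization h (T.realizes_zero Y Z) f (𝟙 Z)
    (by rw [hf, T.E.pull_id])
  exact ⟨b ≫ biprod.fst, by simp [reassoc_of% hb]⟩

/-- Exactness of `C(Y, B) ⟶ C(Y, Z) ⟶ 𝔼(Y, A)` at the middle term. -/
theorem exists_comp_deflation_eq (h : T.s.Realizes x y δ) {Y : C} (f : Y ⟶ Z)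
    (hf : T.E.pull δ f = 0) : ∃ g : Y ⟶ B, g ≫ y = f := by
  obtain ⟨b, -, hb⟩ := T.realization (T.realizes_zero A Y) h (𝟙 A) f
    (by rw [hf, T.E.push_id])
  exact ⟨biprod.inr ≫ b, by rw [Category.assoc, ← hb]; simp⟩

/-- `x · δ = 0`, so that the composite `C(B, Y) ⟶ C(A, Y) ⟶ 𝔼(Z, Y)` vanishes. -/
theorem push_inflation (h : T.s.Realizes x y δ) : T.E.push x δ = 0 := by
  obtain ⟨c, -, hc⟩ := T.et3 h (T.realizes_zero B Z) x (biprod.inl) rfl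
  rw [hc, T.E.pull_zero]

/-- Exactness of `C(A, Y) ⟶ 𝔼(Z, Y) ⟶ 𝔼(B, Y)` at the middle term. -/
theorem exists_push_eq (h : T.s.Realizes x y δ) {Y : C} (η : T.E.Elt Z Y)
    (hη : T.E.pull η y = 0) : ∃ f : A ⟶ Y, T.E.push f δ = η := by
  obtain ⟨D, i, p, hD⟩ := T.exists_realizes η
  obtain ⟨b, hb⟩ := exists_comp_deflation_eq hD y hη
  obtain ⟨a, -, ha⟩ := T.et3_op h hD b (𝟙 Z) (by simp [hb])
  exact ⟨a, by rw [ha, T.E.pull_id]⟩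

/-- Exactness of `C(Y, Z) ⟶ 𝔼(Y, A) ⟶ 𝔼(Y, B)` at the middle term. -/
theorem exists_pull_eq (h : T.s.Realizes x y δ) {Y : C} (η : T.E.Elt Y A)
    (hη : T.E.push x η = 0) : ∃ f : Y ⟶ Z, T.E.pull δ f = η := by
  obtain ⟨D, i, p, hD⟩ := T.exists_realizes η
  obtain ⟨b, hb⟩ := exists_inflation_comp_eq hD x hη
  obtain ⟨c, -, hc⟩ := T.et3 hD h (𝟙 A) b (by simp [hb])
  exact ⟨c, by rw [← hc, T.E.push_id]⟩

/-! ### Resolutions and rigidity -/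

variable {𝒳 : ObjectProperty C}

/-- An object of resolution dimension zero is a retract of an object of `𝒳`. -/
theorem HasResolution.exists_retract {M : C} (h : T.HasResolution 𝒳 0 M) :
    ∃ (X : C) (_ : 𝒳 X) (i : M ⟶ X) (p : X ⟶ M), i ≫ p = 𝟙 M := by
  obtain ⟨x, p, hZ, hX, δ, hδ⟩ := h
  have hδ0 : T.E.pull δ (𝟙 M) = 0 := by
    rw [T.E.pull_id, ← T.E.push_id δ, hZ.eq_of_src (𝟙 _) 0, T.E.push_zero_left T.biadditive]
  obtain ⟨i, hi⟩ := exists_comp_deflation_eq hδ (𝟙 M) hδ0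
  exact ⟨_, hX, i, p, hi⟩

open scoped ZeroObject in
theorem hasResolution_zero_of_mem {X : C} (hX : 𝒳 X) : T.HasResolution 𝒳 0 X := by
  refine .zero (0 : (0 : C) ⟶ X) (𝟙 X) (isZero_zero C) hX ⟨0, ?_⟩
  refine (T.realizes_zero 0 X).trans (Quotient.sound
    ⟨⟨biprod.snd, biprod.inr, ?_, by simp⟩, by simp, by simp⟩)
  exact biprod.hom_ext _ _ ((isZero_zero C).eq_of_tgt _ _) (by simp)

theorem resdimLE_iff {n : ℕ} {M : C} :
    T.resdimLE 𝒳 n M ↔ ∃ k ≤ n, T.HasResolution 𝒳 k M := by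
  simp only [resdimLE, resdim]
  constructor
  · intro h
    by_contra! hk
    have : ((n + 1 : ℕ) : ℕ∞) ≤ n := by
      refine le_trans (le_iInf₂ fun k hres => ?_) h
      by_contra! hlt
      exact hk k (by exact_mod_cast Order.le_of_lt_add_one (by exact_mod_cast hlt)) hres
    have := Nat.cast_le.1 this
    omega
  · rintro ⟨k, hk, h⟩
    exact (iInf₂_le k h).trans (by exact_mod_cast hk)

/-- Dimension shifting along a resolution of `M`: an element of `𝔼ⁱ(X, M)` is sent to `0` in
`𝔼ⁱ⁺¹(X, Z₁)`, where `Z₁` is the first syzygy of `M`, hence it comes from `𝔼ⁱ(X, X₀) = 0`. -/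
theorem HigherExtensions.IsRigid.ext_eq_zero {H : T.HigherExtensions} {m : ℕ}
    (hH : H.IsRigid m 𝒳) {k : ℕ} {M : C} (hM : T.HasResolution 𝒳 k M) :
    ∀ {i : ℕ}, 1 ≤ i → i + k + 1 ≤ m → ∀ {X : C}, 𝒳 X → ∀ e : (H.ext i).Elt X M, e = 0 := by
  induction hM with
  | zero x y hZ hX h =>
    intro i hi him X hX' e
    obtain ⟨δ, hδ⟩ := h
    have hz : (H.conn' i hi δ).app (op X) e = 0 := by
      have := (H.biadditive (i + 1) (by omega)).right (op X)
      have := (((H.ext (i + 1)).obj (op X)).map_isZero hZ)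
      exact (AddCommGrpCat.subsingleton_of_isZero this).elim _ _
    obtain ⟨e', rfl⟩ := (H.exact_conn' i hi hδ X e).1 hz
    rw [hH i hi (by omega) _ _ hX' hX e']
    exact map_zero _
  | succ x y hZ hX h ih =>
    intro i hi him X hX' e
    obtain ⟨δ, hδ⟩ := h
    obtain ⟨e', rfl⟩ := (H.exact_conn' i hi hδ X e).1
      (ih (by omega) (by omega) hX' _)
    rw [hH i hi (by omega) _ _ hX' hX e']
    exact map_zero _

/-- For an `(n + 2)`-rigid `𝒳`, the group `𝔼(X, M)` vanishes if `X` is in `𝒳` and `M` is in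
`𝒳ₙ^∧`. -/
theorem HigherExtensions.IsRigid.elt_eq_zero {H : T.HigherExtensions} {n : ℕ}
    (hH : H.IsRigid (n + 2) 𝒳) {X M : C} (hX : 𝒳 X) (hM : T.resdimLE 𝒳 n M)
    (e : T.E.Elt X M) : e = 0 := by
  obtain ⟨k, hk, hM⟩ := resdimLE_iff.1 hM
  have h := fun e => hH.ext_eq_zero hM le_rfl (by omega) hX e
  rw [H.ext_one] at h
  exact h e

/-- An object of `𝒳ₙ₊₁^∧` is either a retract of an object of `𝒳`, or the last term of a
conflation with first term in `𝒳ₙ^∧` and middle term in `𝒳`. The first case cannot be merged into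
the second one, as the zero object need not belong to `𝒳ₙ^∧`. -/
theorem exists_retract_or_realizes {n : ℕ} {M : C} (hM : T.resdimLE 𝒳 (n + 1) M) :
    (∃ (X : C) (_ : 𝒳 X) (i : M ⟶ X) (p : X ⟶ M), i ≫ p = 𝟙 M) ∨
    ∃ (Z X : C) (_ : T.resdimLE 𝒳 n Z) (_ : 𝒳 X) (x : Z ⟶ X) (y : X ⟶ M) (δ : T.E.Elt M Z),
      T.s.Realizes x y δ := by
  obtain ⟨k, hk, h⟩ := resdimLE_iff.1 hM
  cases k with
  | zero => exact .inl h.exists_retract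
  | succ k =>
    cases h with
    | succ x y hZ hX h =>
      obtain ⟨δ, hδ⟩ := h
      exact .inr ⟨_, _, resdimLE_iff.2 ⟨k, by omega, hZ⟩, hX, x, y, δ, hδ⟩

end ExternalTriangulation

/-! ### Finitely presented modules -/

section Modules

variable {A : Type u} [Category.{u} A] [Preadditive A]

/-- The morphism `A(Z, -) ⟶ F`, `f ↦ F(f)(d)`, given by an element of `F(Z)`, as in the Yoneda lemma. -/
def coyonedaDesc (F : A ⥤ AddCommGrpCat.{u}) [F.Additive] {Z : A} (d : F.obj Z) :
    preadditiveCoyoneda.obj (op Z) ⟶ F where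
  app Y := AddCommGrpCat.ofHom
    { toFun := fun f : Z ⟶ Y => F.map f d
      map_zero' := ConcreteCategory.congr_hom (F.map_zero Z Y) d
      map_add' := fun f g => ConcreteCategory.congr_hom (F.map_add (f := (f : Z ⟶ Y)) (g := g)) d }
  naturality Y Y' g := by
    ext f
    exact ConcreteCategory.congr_hom (F.map_comp (X := Z) f g) d

/-- If `A(W, -) ⟶ A(Z, -) ⟶ F ⟶ 0` is exact at every object, then `F` is finitely presented. -/
theorem isFinitelyPresentedLeftMod_of_exact (F : LeftMod A) {Z W : A} (g : Z ⟶ W)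
    (d : F.obj.obj Z) (hgen : ∀ (Y : A) (e : F.obj.obj Y), ∃ f : Z ⟶ Y, F.obj.map f d = e)
    (hgd : F.obj.map g d = 0)
    (hrel : ∀ (Y : A) (f : Z ⟶ Y), F.obj.map f d = 0 → ∃ h : W ⟶ Y, g ≫ h = f) :
    IsFinitelyPresentedLeftMod A F := by
  have := F.property
  let S : ShortComplex (A ⥤ AddCommGrpCat.{u}) :=
    { f := preadditiveCoyoneda.map g.op
      g := coyonedaDesc F.obj d
      zero := by
        ext Y f
        refine (ConcreteCategory.congr_hom (F.obj.map_comp g f) d).trans ?_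
        exact (congrArg (F.obj.map f) hgd).trans (map_zero (F.obj.map f).hom) }
  have hS : S.Exact := by
    -- Evaluation functors are exact, so homology may be computed objectwise.
    rw [ShortComplex.exact_iff_isZero_homology, Functor.isZero_iff]
    intro Y
    refine IsZero.of_iso ?_ (S.mapHomologyIso ((evaluation _ _).obj Y)).symm
    rw [← ShortComplex.exact_iff_isZero_homology, ShortComplex.ab_exact_iff]
    exact hrel Y
  have hepi : Epi S.g := by
    rw [NatTrans.epi_iff_epi_app]
    intro Y
    rw [AddCommGrpCat.epi_iff_surjective]
    exact hgen Y
  let Z' : Fin 1 → A := fun _ => W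
  let W' : Fin 1 → A := fun _ => Z
  refine ⟨1, 1, Z', W',
    (coproductUniqueIso fun i => preadditiveCoyoneda.obj (op (Z' i))).hom ≫ S.f ≫
      (coproductUniqueIso fun i => preadditiveCoyoneda.obj (op (W' i))).inv, ⟨?_⟩⟩
  exact cokernelEpiComp _ _ ≪≫ cokernelCompIsIso _ _ ≪≫
    (cokernelIsCokernel S.f).coconePointUniqueUpToIso hS.gIsCokernel

theorem isFinitelyPresentedLeftMod_of_isZero (F : LeftMod A)
    (hF : ∀ (Y : A) (e : F.obj.obj Y), e = 0) : IsFinitelyPresentedLeftMod A F := by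
  have hF0 : IsZero F.obj := by
    rw [Functor.isZero_iff]
    intro Y
    have : Subsingleton (F.obj.obj Y) := ⟨fun a b => (hF Y a).trans (hF Y b).symm⟩
    exact AddCommGrpCat.isZero_of_subsingleton _
  have h0 : IsZero (∐ fun i : Fin 0 =>
      preadditiveCoyoneda.obj (op ((Fin.elim0 : Fin 0 → A) i))) :=
    (IsZero.iff_id_eq_zero _).2 (Sigma.hom_ext _ _ fun i => i.elim0)
  refine ⟨0, 0, Fin.elim0, Fin.elim0, 0, ⟨cokernelZeroIsoTarget ≪≫ h0.iso hF0⟩⟩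

end Modules

/-! ### The functors `𝔾` and `𝕂` -/

namespace ExternalTriangulation

variable {C : Type u} [Category.{u} C] [Preadditive C] [HasZeroObject C] [HasBinaryBiproducts C]
  {T : ExternalTriangulation C} {𝒳 : ObjectProperty C} {n : ℕ}

/-- For an `(n + 2)`-rigid `𝒳`, the functor `𝔼(M, -)` vanishes on `𝒳ₙ^∧` if `M` is a retract of an
object of `𝒳`. -/
theorem elt_eq_zero_of_retract {H : T.HigherExtensions} (h𝒳 : H.IsRigid (n + 2) 𝒳) {M X Y : C}
    (hX : 𝒳 X) (i : M ⟶ X) (p : X ⟶ M) (hip : i ≫ p = 𝟙 M) (hY : T.resdimLE 𝒳 n Y)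
    (e : T.E.Elt M Y) : e = 0 := by
  rw [← T.E.pull_id e, ← hip, T.E.pull_comp, h𝒳.elt_eq_zero hX hY (T.E.pull e p),
    T.E.pull_zero]

/-- The presentation of `𝔼(M, -)` on `𝒳ₙ^∧` given by a conflation `Z ⟶ X ⟶ M`, namely the cokernel
of `(X, -) ⟶ (Z, -)`. Both representable functors may be taken over the costable category, because a
morphism `f` with `𝔼(-, f) = 0` annihilates the extension `δ ∈ 𝔼(M, Z)`. -/
theorem costableModule_isFinitelyPresented {H : T.HigherExtensions} (h𝒳 : H.IsRigid (n + 2) 𝒳)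
    {M : C} (hM : T.resdimLE 𝒳 (n + 1) M) :
    IsFinitelyPresentedLeftMod _ (T.costableModule (T.resdimLE 𝒳 n) (op M)) := by
  obtain ⟨X, hX, i, p, hip⟩ | ⟨Z, X, hZ, hX, x, y, δ, h⟩ := exists_retract_or_realizes hM
  · apply isFinitelyPresentedLeftMod_of_isZero
    rintro ⟨Y⟩ e
    exact elt_eq_zero_of_retract h𝒳 hX i p hip Y.property e
  · have hX' : T.resdimLE 𝒳 n X := resdimLE_iff.2 ⟨0, by omega, hasResolution_zero_of_mem hX⟩
    let x' : (⟨Z, hZ⟩ : (T.resdimLE 𝒳 n).FullSubcategory) ⟶ ⟨X, hX'⟩ := ObjectProperty.homMk x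
    refine isFinitelyPresentedLeftMod_of_exact _ ((T.injectiveIdeal _).proj.map x') δ ?_
      (push_inflation h) ?_
    · rintro ⟨Y⟩ e
      obtain ⟨f, hf⟩ := exists_push_eq h e (h𝒳.elt_eq_zero hX Y.property _)
      exact ⟨(T.injectiveIdeal _).proj.map (ObjectProperty.homMk f), hf⟩
    · rintro ⟨Y⟩ ⟨f⟩ hf
      obtain ⟨g, hg⟩ := exists_inflation_comp_eq h f.hom hf
      refine ⟨(T.injectiveIdeal _).proj.map (ObjectProperty.homMk g), ?_⟩
      rw [← Functor.map_comp]
      exact congrArg _ (ObjectProperty.hom_ext _ hg)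

/-- Fullness of `𝔾`. If `δ ∈ 𝔼(N, Z)` is the extension of a conflation `Z ⟶ X ⟶ N`, then `φ(δ)`
vanishes in `𝔼(M, X)` by naturality, so `φ(δ) = δ · f` for some `f : M ⟶ N`. As `δ` generates
`𝔼(N, -)` on `𝒳ₙ^∧`, this determines `φ`. -/
theorem costableFunctor_full {H : T.HigherExtensions} (h𝒳 : H.IsRigid (n + 2) 𝒳)
    {M N : C} (hN : T.resdimLE 𝒳 (n + 1) N)
    (φ : T.costableModule (T.resdimLE 𝒳 n) (op N) ⟶ T.costableModule (T.resdimLE 𝒳 n) (op M)) :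
    ∃ f : M ⟶ N, (T.costableFunctor (T.resdimLE 𝒳 n)).map f.op = φ := by
  have key (f : M ⟶ N) (hf : ∀ (Y : C) (hY : T.resdimLE 𝒳 n Y) (e : T.E.Elt N Y),
      T.E.pull e f = φ.hom.app ((T.injectiveIdeal _).proj.obj ⟨Y, hY⟩) e) :
      (T.costableFunctor (T.resdimLE 𝒳 n)).map f.op = φ := by
    ext ⟨Y⟩ e
    exact hf Y.obj Y.property e
  have nat {Y Y' : C} (hY : T.resdimLE 𝒳 n Y) (hY' : T.resdimLE 𝒳 n Y') (g : Y ⟶ Y')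
      (e : T.E.Elt N Y) :
      (φ.hom.app ((T.injectiveIdeal _).proj.obj ⟨Y', hY'⟩) (T.E.push g e) : T.E.Elt M Y') =
        T.E.push g (φ.hom.app ((T.injectiveIdeal _).proj.obj ⟨Y, hY⟩) e : T.E.Elt M Y) :=
    ConcreteCategory.congr_hom (φ.hom.naturality ((T.injectiveIdeal _).proj.map
      (ObjectProperty.homMk g : (⟨Y, hY⟩ : (T.resdimLE 𝒳 n).FullSubcategory) ⟶ ⟨Y', hY'⟩))) e
  obtain ⟨X, hX, i, p, hip⟩ | ⟨Z, X, hZ, hX, x, y, δ, h⟩ := exists_retract_or_realizes hN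
  · refine ⟨0, key 0 fun Y hY e => ?_⟩
    obtain rfl := elt_eq_zero_of_retract h𝒳 hX i p hip hY e
    exact (T.E.pull_zero _).trans
      (map_zero (φ.hom.app ((T.injectiveIdeal _).proj.obj ⟨Y, hY⟩)).hom).symm
  · have hX' : T.resdimLE 𝒳 n X := resdimLE_iff.2 ⟨0, by omega, hasResolution_zero_of_mem hX⟩
    obtain ⟨f, hf⟩ := exists_pull_eq h (φ.hom.app ((T.injectiveIdeal _).proj.obj ⟨Z, hZ⟩) δ)
      (by rw [← nat hZ hX' x δ, push_inflation h]; exact map_zero (φ.hom.app _).hom)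
    refine ⟨f, key f fun Y hY e => ?_⟩
    obtain ⟨g, rfl⟩ := exists_push_eq h e (h𝒳.elt_eq_zero hX hY _)
    rw [nat hZ hY, ← hf, T.E.push_pull]

theorem mem_idealN_iff {M N : (T.resdimLE 𝒳 (n + 1)).FullSubcategory} (f : M ⟶ N) :
    f ∈ (T.idealN 𝒳 n).mem M N ↔
      ∀ (Y : C) (_ : T.resdimLE 𝒳 n Y) (e : T.E.Elt N.obj Y), T.E.pull e f.hom = 0 := by
  change (T.functorG 𝒳 n).rightOp.map f = 0 ↔ _
  constructor
  · intro h Y hY e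
    have h' : (T.functorG 𝒳 n).map f.op = 0 := congrArg Quiver.Hom.unop h
    have := NatTrans.congr_app (congrArg (fun k => k.hom) h')
      ((T.injectiveIdeal _).proj.obj ⟨Y, hY⟩)
    exact ConcreteCategory.congr_hom this e
  · intro h
    refine congrArg Quiver.Hom.op (?_ : (T.functorG 𝒳 n).map f.op = 0)
    ext ⟨Y⟩ e
    exact h Y.obj Y.property e

/-- A morphism `f : M ⟶ N` of the ideal `𝒩` annihilates the extension `δ ∈ 𝔼(N, Z)` of a conflation
`Z ⟶ X ⟶ N`, hence factors through `X`. Conversely `𝔼(X, -)` vanishes on `𝒳ₙ^∧` for `X` in `𝒳`. -/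
theorem morphisms_idealN {H : T.HigherExtensions} (h𝒳 : H.IsRigid (n + 2) 𝒳) :
    (T.idealN 𝒳 n).morphisms = factorsThroughClass 𝒳 (T.resdimLE 𝒳 (n + 1)) := by
  ext M N f
  refine (mem_idealN_iff f).trans ⟨fun hf => ?_, ?_⟩
  · obtain ⟨X, hX, i, p, hip⟩ | ⟨Z, X, hZ, hX, x, y, δ, h⟩ := exists_retract_or_realizes N.property
    · exact ⟨X, hX, f.hom ≫ i, p, by simp [hip]⟩
    · obtain ⟨g, hg⟩ := exists_comp_deflation_eq h f.hom (hf Z hZ δ)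
      exact ⟨X, hX, g, y, hg.symm⟩
  · rintro ⟨X, hX, a, b, hab⟩ Y hY e
    rw [hab, T.E.pull_comp, h𝒳.elt_eq_zero hX hY (T.E.pull e b), T.E.pull_zero]

instance functorK_additive : (T.functorK 𝒳 n).Additive where
  map_add {M N f g} := by
    obtain ⟨⟨f⟩⟩ := f
    obtain ⟨⟨g⟩⟩ := g
    exact (T.functorG 𝒳 n).map_add (f := f.op) (g := g.op)

instance functorK_faithful : (T.functorK 𝒳 n).Faithful where
  map_injective {M N} f g h := by
    obtain ⟨⟨M⟩⟩ := M
    obtain ⟨⟨N⟩⟩ := N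
    obtain ⟨⟨f⟩⟩ := f
    obtain ⟨⟨g⟩⟩ := g
    refine congrArg Quiver.Hom.op (CategoryTheory.Quotient.sound _ ?_)
    change (T.functorG 𝒳 n).rightOp.map (f - g) = 0
    rw [Functor.map_sub, sub_eq_zero]
    exact congrArg Quiver.Hom.op h

theorem functorK_full {H : T.HigherExtensions} (h𝒳 : H.IsRigid (n + 2) 𝒳) :
    (T.functorK 𝒳 n).Full where
  map_surjective {N M} φ := by
    obtain ⟨⟨M⟩⟩ := M
    obtain ⟨⟨N⟩⟩ := N
    obtain ⟨f, hf⟩ := costableFunctor_full h𝒳 N.property φ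
    exact ⟨((T.idealN 𝒳 n).proj.map (ObjectProperty.homMk f)).op, hf⟩

end ExternalTriangulation

theorem mainTheorem2 {C : Type u} [SmallCategory.{u} C] [Preadditive C] [HasZeroObject C]
    [HasBinaryBiproducts C]
    (T : ExternalTriangulation C) (H : T.HigherExtensions) (n : ℕ) (𝒳 : ObjectProperty C)
    (h𝒳 : H.IsRigid (n + 2) 𝒳) :
    (∃ hfp : ∀ M, IsFinitelyPresentedLeftMod _ ((T.functorK 𝒳 n).obj M),
      ((IsFinitelyPresentedLeftMod _).lift (T.functorK 𝒳 n) hfp).Additive ∧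
      ((IsFinitelyPresentedLeftMod _).lift (T.functorK 𝒳 n) hfp).Full ∧
      ((IsFinitelyPresentedLeftMod _).lift (T.functorK 𝒳 n) hfp).Faithful) ∧
    (T.idealN 𝒳 n).morphisms = factorsThroughClass 𝒳 (T.resdimLE 𝒳 (n + 1)) := by
  have hfp (M) : IsFinitelyPresentedLeftMod _ ((T.functorK 𝒳 n).obj M) :=
    ExternalTriangulation.costableModule_isFinitelyPresented h𝒳 M.unop.as.property
  refine ⟨⟨hfp, ⟨fun {_ _ f g} => ?_⟩, ?_, ?_⟩, ExternalTriangulation.morphisms_idealN h𝒳⟩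
  · exact ObjectProperty.hom_ext _ ((T.functorK 𝒳 n).map_add (f := f) (g := g))
  · have := ExternalTriangulation.functorK_full h𝒳
    exact Functor.Full.of_comp_faithful_iso (ObjectProperty.liftCompιIso _ (T.functorK 𝒳 n) hfp)
  · exact Functor.Faithful.of_comp_iso (ObjectProperty.liftCompιIso _ (T.functorK 𝒳 n) hfp)
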